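/- **Setting.** Let $k\ge 1$, $d,n\ge 0$, $\mathcal Z=\{0,\dots,k-1\}$, and let $\mathbf x_1,\dots,\mathbf x_n\in\mathcal Z^d$ be a dataset. An *independent permutation* is $\pi(\mathbf x)=(\pi_0(x_0),\dots,\pi_{d-1}(x_{d-1}))$ with each $\pi_j$ a permutation of $\mathcal Z$; for a count matrix $c\in\mathbb N^{d\times k}$ put $\pi[c](j,a)=c(j,\pi_j^{-1}(a))$. A *tree-structured permutation* (TSP) is a finite binary tree in which every node $N$ carries an independent permutation $\pi_N$ and every internal node also a split feature $s$ and a set $v\subseteq\mathcal Z$ of split values. It defines $\sigma:\mathcal Z^d\to\mathcal Z^d$: starting at the root, an input $\mathbf x$ reaching a node $N$ is replaced by $\pi_N(\mathbf x)$, and then goes to the left child if $\pi_N(\mathbf x)_s\in v$ and to the right child otherwise, until a leaf has been processed. The node domains are $\mathcal D(N_0)=\mathcal Z^d$ for the root and $\mathcal D(N_{\rm left})=\{\pi_N(\mathbf x):\mathbf x\in\mathcal D(N),\ \pi_N(\mathbf x)_s\in v\}$, $\mathcal D(N_{\rm right})=\{\pi_N(\mathbf x):\mathbf x\in\mathcal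 D(N),\ \pi_N(\mathbf x)_s\notin v\}$; let $\mathcal D_j(N)=\{x_j:\mathbf x\in\mathcal D(N)\}$. A TSP is *valid* (satisfies the invertibility constraint) if $\pi_N(\mathbf x)\in\mathcal D(N)$ for every node $N$ and every $\mathbf x\in\mathcal D(N)$. Two TSPs $A,B$ are *tree equivalent* if their trees have the same nodes and edges and, for corresponding nodes $N^A,N^B$ and all $\mathbf x$, $\sigma^A(\mathbf x)\in\mathcal D(N^A)\Leftrightarrow\sigma^B(\mathbf x)\in\mathcal D(N^B)$. A *tree structure* $\mathcal T$ is a binary tree with a split $(s,v)$ at each internal node, identified with the TSP all of whose node permutations are the identity. Let $\Sigma(\mathcal T)$ be the set of valid TSPs that are tree equivalent to $\mathcal T$. For a TSP with map $\sigma$ put $$\mathrm{NLL}(\sigma)=\min_{Q}\ -\frac1n\sum_{i=1}^n\log Q(\sigma(\mathbf x_i)),$$ where $Q$ ranges over the independent (product) distributions on $\mathcal Z^d$, $\log 0=-\infty$, and the expression is $0$ if $n=0$. **Two-pass procedure.** *Pass 1 (LearnLocalPermutations), bottom-up.* With $\mathcal D(N)$ the node domains of $\mathcal T$, set $\tilde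 c_N^{\rm init}(j,a)=\#\{i: x_{i,j}=a,\ \mathbf x_i\in\mathcal D(N)\}$ at each leaf and $\tilde c_N^{\rm init}=\tilde c_{N_{\rm left}}+\tilde c_{N_{\rm right}}$ at each internal node. For each $j$ let $\tilde\pi_{N,j}$ be the permutation that sorts $\tilde c_N^{\rm init}(j,\cdot)$ in ascending order on $\mathcal D_j(N)$ and fixes all categories outside $\mathcal D_j(N)$ (ties being broken by an arbitrary fixed rule depending on the counts and the domain), and let $\tilde c_N=\tilde\pi_N[\tilde c_N^{\rm init}]$. *Pass 2 (ConstructEquivalentTree), top-down.* With $\pi_{\rm anc}=\mathrm{id}$ at the root, set $\pi_N^{\rm new}=\pi_{\rm anc}\circ\tilde\pi_N\circ\pi_{\rm anc}^{-1}$ at each node; at an internal node keep $s$, set $v^{\rm new}=\{(\pi_{\rm anc}\circ\tilde\pi_N)_s(a):a\in v\}$, and pass $\pi_N^{\rm new}\circ\pi_{\rm anc}$ to both children as their ancestor permutation. **Theorem (Algorithm finds optimal permutations).** For every dataset, every tree structure $\mathcal T$ and every tie-breaking rule, the TSP $\sigma^{\rm new}$ produced by the two-pass procedure is valid and tree equivalent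 to $\mathcal T$, i.e. $\sigma^{\rm new}\in\Sigma(\mathcal T)$, and it attains the optimal negative log-likelihood among these: $$\mathrm{NLL}(\sigma^{\rm new})\le \mathrm{NLL}(\sigma)\qquad\text{for all }\sigma\in\Sigma(\mathcal T),$$ where for every $\sigma\in\Sigma(\mathcal T)$ the minimum over $Q$ defining $\mathrm{NLL}(\sigma)$ is attained. -/

import Mathlib

noncomputable section

namespace TreeFlow

/-- Configurations: `d` categorical features, each with values in `{0, …, k-1}`. -/
abbrev Config (d k : ℕ) : Type := Fin d → Fin k

/-- Independent (feature-wise) permutations. The pointwise group structure is composition: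
`(π * ρ) j = π j ∘ ρ j`. -/
abbrev IndepPerm (d k : ℕ) : Type := Fin d → Equiv.Perm (Fin k)

/-- `π(x) = [π_0(x_0), …, π_{d-1}(x_{d-1})]`. -/
def IndepPerm.act {d k : ℕ} (π : IndepPerm d k) (x : Config d k) : Config d k :=
  fun j => π j (x j)

/-- Count matrices `c(j, a)`. -/
abbrev Counts (d k : ℕ) : Type := Fin d → Fin k → ℕ

/-- `π[c](j, a) = c(j, π_j⁻¹(a))`. -/
def permuteCounts {d k : ℕ} (π : IndepPerm d k) (c : Counts d k) : Counts d k :=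
  fun j a => c j ((π j)⁻¹ a)

/-! ### Tree-structured permutations -/

/-- A binary decision tree in which every node carries an independent permutation `π`, and every
internal node also a split feature `s` and a set `v` of split values. No validity is required
here. -/
inductive TSP (d k : ℕ) : Type
  | leaf (π : IndepPerm d k) : TSP d k
  | node (π : IndepPerm d k) (s : Fin d) (v : Finset (Fin k)) (left right : TSP d k) : TSP d k

/-- The map `σ_T`: permute on reaching a node, then go left if the split feature of the permuted
input lies in `v`, and right otherwise. -/
def TSP.eval {d k : ℕ} : TSP d k → Config d k → Config d k
  | .leaf π, x => π.act x
  | .node π s v l r, x => if π.act x s ∈ v then l.eval (π.act x) else r.eval (π.act x)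

/-- Domain of the left child of a node with domain `D`, permutation `π` and split `(s, v)`. -/
def leftDomain {d k : ℕ} (D : Set (Config d k)) (π : IndepPerm d k) (s : Fin d)
    (v : Finset (Fin k)) : Set (Config d k) :=
  {y | ∃ x ∈ D, π.act x s ∈ v ∧ y = π.act x}

/-- Domain of the right child of a node with domain `D`, permutation `π` and split `(s, v)`. -/
def rightDomain {d k : ℕ} (D : Set (Config d k)) (π : IndepPerm d k) (s : Fin d)
    (v : Finset (Fin k)) : Set (Config d k) :=
  {y | ∃ x ∈ D, π.act x s ∉ v ∧ y = π.act x}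

inductive Side : Type
  | left
  | right

/-- A node is named by its address: the sequence of turns that leads to it from the root. -/
abbrev Address : Type := List Side

/-- The addresses of the nodes of a tree. -/
def TSP.nodes {d k : ℕ} : TSP d k → Set Address
  | .leaf _ => {[]}
  | .node _ _ _ l r => {[]} ∪ (List.cons Side.left '' l.nodes) ∪ (List.cons Side.right '' r.nodes)

/-- The domain of the node with a given address in a subtree whose root has domain `D`
(the empty set if there is no such node). -/
def TSP.domainFrom {d k : ℕ} : TSP d k → Set (Config d k) → Address → Set (Config d k)
  | .leaf _, D, [] => D
  | .leaf _, _, _ :: _ => ∅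
  | .node _ _ _ _ _, D, [] => D
  | .node π s v l _, D, Side.left :: p => l.domainFrom (leftDomain D π s v) p
  | .node π s v _ r, D, Side.right :: p => r.domainFrom (rightDomain D π s v) p

/-- The node domain `𝒟(N)`; the domain of the root is the set of all configurations. -/
def TSP.domain {d k : ℕ} (T : TSP d k) (p : Address) : Set (Config d k) :=
  T.domainFrom Set.univ p

/-- The invertibility constraint in a subtree whose root has domain `D`. -/
def TSP.IsValidFrom {d k : ℕ} : TSP d k → Set (Config d k) → Prop
  | .leaf π, D => ∀ x ∈ D, π.act x ∈ D
  | .node π s v l r, D => (∀ x ∈ D, π.act x ∈ D) ∧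
      l.IsValidFrom (leftDomain D π s v) ∧ r.IsValidFrom (rightDomain D π s v)

/-- The TSP is valid: the permutation of every node maps the domain of the node into itself. -/
def TSP.IsValid {d k : ℕ} (T : TSP d k) : Prop :=
  T.IsValidFrom Set.univ

/-- Tree equivalence: the same nodes and edges, and
`σ_A(x) ∈ 𝒟(N^A) ↔ σ_B(x) ∈ 𝒟(N^B)` for every configuration `x` and every node `N`. -/
def TreeEquivalent {d k : ℕ} (A B : TSP d k) : Prop :=
  A.nodes = B.nodes ∧
    ∀ p ∈ A.nodes, ∀ x : Config d k, A.eval x ∈ A.domain p ↔ B.eval x ∈ B.domain p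

/-! ### Tree structures -/

/-- A tree structure: a binary decision tree with split information and no permutations. -/
inductive SplitTree (d k : ℕ) : Type
  | leaf : SplitTree d k
  | node (s : Fin d) (v : Finset (Fin k)) (left right : SplitTree d k) : SplitTree d k

/-- The TSP with a given tree structure all of whose node permutations are the identity. -/
def SplitTree.toTSP {d k : ℕ} : SplitTree d k → TSP d k
  | .leaf => .leaf 1
  | .node s v l r => .node 1 s v l.toTSP r.toTSP

/-- The set `Σ(T)` of valid TSPs that are tree equivalent to the tree structure `T`. -/
def equivalentTSPs {d k : ℕ} (T : SplitTree d k) : Set (TSP d k) :=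
  {B | B.IsValid ∧ TreeEquivalent B T.toTSP}

/-! ### Negative log-likelihood -/

/-- `-(1/n) ∑ i, log Q(σ_B(x_i))` for the independent distribution `Q(z) = ∏ j, Q_j(z_j)`.
It takes values in the extended reals, with `log 0 = -∞`. -/
def nll {n d k : ℕ} (X : Fin n → Config d k) (B : TSP d k) (Q : Fin d → PMF (Fin k)) : EReal :=
  -((1 / (n : EReal)) * ∑ i, ENNReal.log (∏ j, Q j (B.eval (X i) j)))

/-- The negative log-likelihood of `B`, optimized over all independent base distributions. -/
def optNLL {n d k : ℕ} (X : Fin n → Config d k) (B : TSP d k) : EReal :=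
  ⨅ Q : Fin d → PMF (Fin k), nll X B Q

/-! ### First pass -/

/-- A rule for breaking ties when counts `c` are sorted on `D`: among categories with the same
count, those with the smaller image under `tie c D` come first. With the constant rule `1` the
sort is stable, and every way of sorting comes from some rule. -/
abbrev TieBreak (k : ℕ) : Type := (Fin k → ℕ) → Finset (Fin k) → Equiv.Perm (Fin k)

/-- The permutation of the categories that sorts the counts `c` in ascending order on `D` and fixes
every category outside `D`. If `e i` is the `i`-th smallest category in `D` and `e (ρ i)` the one
with the `i`-th smallest count, then it sends `e (ρ i)` to `e i`. -/
def sort1D {k : ℕ} (tie : TieBreak k) (c : Fin k → ℕ) (D : Finset (Fin k)) :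
    Equiv.Perm (Fin k) :=
  let e : Fin D.card ≃o {a // a ∈ D} := D.orderIsoOfFin rfl
  let key : Fin D.card → ℕ ×ₗ Fin k := fun i => toLex (c (e i), tie c D (e i))
  Equiv.Perm.ofSubtype (e.toEquiv.permCongr (Tuple.sort key)⁻¹)

open scoped Classical in
/-- The domain `{x_j : x ∈ D}` of the `j`-th feature. -/
def featureDomain {d k : ℕ} (D : Set (Config d k)) (j : Fin d) : Finset (Fin k) :=
  Finset.univ.filter fun a => ∃ x ∈ D, x j = a

open scoped Classical in
/-- The number of samples `x_i` in `D` with `x_{i,j} = a`. -/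
def rawCounts {n d k : ℕ} (X : Fin n → Config d k) (D : Set (Config d k)) : Counts d k :=
  fun j a => (Finset.univ.filter fun i => X i j = a ∧ X i ∈ D).card

/-- A tree structure whose nodes carry local permutations `π` and sorted local counts `c`. -/
inductive LocalTree (d k : ℕ) : Type
  | leaf (π : IndepPerm d k) (c : Counts d k) : LocalTree d k
  | node (π : IndepPerm d k) (c : Counts d k) (s : Fin d) (v : Finset (Fin k))
      (left right : LocalTree d k) : LocalTree d k

/-- The local counts of the root. -/
def LocalTree.counts {d k : ℕ} : LocalTree d k → Counts d k
  | .leaf _ c => c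
  | .node _ c _ _ _ _ => c

/-- The first pass, bottom-up, at a node with domain `D`. The initial local counts are the raw
counts at a leaf and the sum of the local counts of the children at an internal node. They are
sorted feature by feature on the domain of the node. -/
def learnLocalPermutations {n d k : ℕ} (tie : TieBreak k) (X : Fin n → Config d k) :
    SplitTree d k → Set (Config d k) → LocalTree d k
  | .leaf, D =>
      let c₀ : Counts d k := rawCounts X D
      let π : IndepPerm d k := fun j => sort1D tie (c₀ j) (featureDomain D j)
      .leaf π (permuteCounts π c₀)
  | .node s v l r, D =>
      let L := learnLocalPermutations tie X l {x ∈ D | x s ∈ v}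
      let R := learnLocalPermutations tie X r {x ∈ D | x s ∉ v}
      let c₀ : Counts d k := L.counts + R.counts
      let π : IndepPerm d k := fun j => sort1D tie (c₀ j) (featureDomain D j)
      .node π (permuteCounts π c₀) s v L R

/-! ### Second pass -/

/-- The second pass, top-down, with ancestor permutation `anc`: a local permutation `π` is replaced
by its conjugate `anc ∘ π ∘ anc⁻¹`, and the split values by their image under `anc ∘ π`, which is
the composition of the new permutations on the path from the root down to and including the
node. -/
def constructEquivalentTree {d k : ℕ} : LocalTree d k → IndepPerm d k → TSP d k
  | .leaf π _, anc => .leaf (anc * π * anc⁻¹)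
  | .node π _ s v l r, anc =>
      let πnew : IndepPerm d k := anc * π * anc⁻¹
      let ancChild : IndepPerm d k := πnew * anc
      .node πnew s (v.image fun a => ancChild s a)
        (constructEquivalentTree l ancChild) (constructEquivalentTree r ancChild)

/-- The two-pass procedure applied to data `X` and tree structure `T`. -/
def learnedTSP {n d k : ℕ} (tie : TieBreak k) (X : Fin n → Config d k) (T : SplitTree d k) :
    TSP d k :=
  constructEquivalentTree (learnLocalPermutations tie X T Set.univ) 1

end TreeFlow

end

open TreeFlow

/-!
The optimal negative log-likelihood of a tree `B` depends only on the counts `c(j, a)` of the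
categories `a` in feature `j` of its outputs: up to monotone operations it is the largest value of
`∏ j, ∏ a, Q_j(a) ^ c(j, a)`. Moving mass so that the counts of a feature become more unequal can
only increase this value. Unequal is meant in the sense of majorization (`MajorizedBy`), and
likelihoods are compared in `MajorizedBy.exists_perm_prod_pow_le`: arrange `q` in the order of the
majorizing counts and sum by parts. The best `Q` exists by compactness.

A valid tree is tree equivalent to `T` exactly if it sends every input along the path along which
`T` sends it (`mem_equivalentTSPs_iff`). So at every node the output counts of a tree in `Σ(T)` are
the sum of those of the two children, taken over the same samples for all trees in `Σ(T)`. The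
learned tree realizes the local counts of the first pass (`outCounts_learned`), and by induction from
the leaves these majorize the output counts of every tree in `Σ(T)` (`outCounts_majorizedBy`).

For the inductive step at a split in the feature `s`, consider one feature `j`.
* If `j = s`, the children see disjoint sets of categories. An independent permutation is injective
  in each feature, so the output counts of the children have disjoint supports in every tree of
  `Σ(T)`, and majorization passes to the sum (`MajorizedBy.add_of_disjoint`).
* If `j ≠ s`, both children have the feature domain of their parent, as node domains are boxes,
  unless a child has an empty domain and no counts. The local counts of the children ascend on this
  common domain, so the same categories collect the most in both, and majorization passes to the
  sum (`MajorizedBy.add_of_sorted`).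
-/

namespace TreeFlow

open Finset

/-! ### Majorization of counts -/

/-- The counts `a` are majorized by the counts `b`: the totals agree, and whatever a set of
categories collects under `a` is collected under `b` by some set that is not larger. This is
majorization without sorting: the best set of `m` categories collects at least as much under `b`
as under `a`. -/
def MajorizedBy {k : ℕ} (a b : Fin k → ℕ) : Prop :=
  ∑ x, a x = ∑ x, b x ∧
    ∀ S : Finset (Fin k), ∃ S' : Finset (Fin k), S'.card ≤ S.card ∧ ∑ x ∈ S, a x ≤ ∑ x ∈ S', b x

theorem MajorizedBy.refl {k : ℕ} (a : Fin k → ℕ) : MajorizedBy a a :=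
  ⟨rfl, fun S => ⟨S, le_rfl, le_rfl⟩⟩

theorem MajorizedBy.comp_perm_left {k : ℕ} {a b : Fin k → ℕ} (h : MajorizedBy a b)
    (σ : Equiv.Perm (Fin k)) : MajorizedBy (fun x => a (σ x)) b := by
  refine ⟨(Equiv.sum_comp σ a).trans h.1, fun S => ?_⟩
  obtain ⟨S', hc, hs⟩ := h.2 (S.map σ.toEmbedding)
  exact ⟨S', by simpa using hc, by simpa using hs⟩

theorem MajorizedBy.comp_perm_right {k : ℕ} {a b : Fin k → ℕ} (h : MajorizedBy a b)
    (σ : Equiv.Perm (Fin k)) : MajorizedBy a (fun x => b (σ x)) := by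
  refine ⟨h.1.trans (Equiv.sum_comp σ b).symm, fun S => ?_⟩
  obtain ⟨S', hc, hs⟩ := h.2 S
  refine ⟨S'.map σ.symm.toEmbedding, by simpa using hc, by simpa using hs⟩

/-- Counts with disjoint supports may be added on the majorized side: a set of categories splits
into its parts in the two supports. -/
theorem MajorizedBy.add_of_disjoint {k : ℕ} {a₁ a₂ b₁ b₂ : Fin k → ℕ} (h₁ : MajorizedBy a₁ b₁)
    (h₂ : MajorizedBy a₂ b₂) (hd : ∀ x, a₁ x = 0 ∨ a₂ x = 0) :
    MajorizedBy (a₁ + a₂) (b₁ + b₂) := by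
  refine ⟨by simp [sum_add_distrib, h₁.1, h₂.1], fun S => ?_⟩
  obtain ⟨S₁, hc₁, hs₁⟩ := h₁.2 (S.filter fun x => a₁ x ≠ 0)
  obtain ⟨S₂, hc₂, hs₂⟩ := h₂.2 (S.filter fun x => ¬ a₁ x ≠ 0)
  refine ⟨S₁ ∪ S₂, ?_, ?_⟩
  · have := card_filter_add_card_filter_not (s := S) (fun x => a₁ x ≠ 0)
    have := card_union_le S₁ S₂
    omega
  · have e₁ : ∑ x ∈ S, a₁ x = ∑ x ∈ S with a₁ x ≠ 0, a₁ x := (sum_filter_ne_zero S).symm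
    have e₂ : ∑ x ∈ S, a₂ x = ∑ x ∈ S with ¬ a₁ x ≠ 0, a₂ x := by
      refine (sum_subset (filter_subset _ _) fun x hx hx' => ?_).symm
      rcases hd x with h | h
      · exact absurd (mem_filter.2 ⟨hx, not_not.2 h⟩) hx'
      · exact h
    simp only [Pi.add_apply, sum_add_distrib]
    rw [e₁, e₂]
    exact add_le_add
      (hs₁.trans (sum_le_sum_of_subset subset_union_left))
      (hs₂.trans (sum_le_sum_of_subset subset_union_right))

/-- The counts `b` vanish outside `F` and ascend on `F`. -/
def SortedOn {k : ℕ} (b : Fin k → ℕ) (F : Finset (Fin k)) : Prop :=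
  (∀ x ∉ F, b x = 0) ∧ MonotoneOn b F

theorem SortedOn.add {k : ℕ} {b₁ b₂ : Fin k → ℕ} {F : Finset (Fin k)} (h₁ : SortedOn b₁ F)
    (h₂ : SortedOn b₂ F) : SortedOn (b₁ + b₂) F :=
  ⟨fun x hx => by simp [h₁.1 x hx, h₂.1 x hx], h₁.2.add h₂.2⟩

theorem SortedOn.of_empty {k : ℕ} {b : Fin k → ℕ} (h : SortedOn b ∅) (F : Finset (Fin k)) :
    SortedOn b F := by
  have h0 : ∀ x, b x = 0 := fun x => h.1 x (notMem_empty x)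
  exact ⟨fun x _ => h0 x, fun x _ y _ _ => by simp [h0]⟩

/-- An upper subset `U` of `F` collects at least as much of counts sorted on `F` as any set that
contains at most as many categories of `F` as `U`. -/
theorem SortedOn.sum_le {k : ℕ} {b : Fin k → ℕ} {F U : Finset (Fin k)} (h : SortedOn b F)
    (hU : U ⊆ F) (hup : ∀ x ∈ F, x ∉ U → ∀ u ∈ U, x ≤ u) (S : Finset (Fin k))
    (hc : (S ∩ F).card ≤ U.card) : ∑ x ∈ S, b x ≤ ∑ x ∈ U, b x := by
  have e : ∑ x ∈ S, b x = ∑ x ∈ S ∩ F, b x := by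
    refine (sum_subset inter_subset_left fun x hx hx' => h.1 x fun hF => ?_).symm
    exact hx' (mem_inter.2 ⟨hx, hF⟩)
  rw [e, ← sum_sdiff_le_sum_sdiff]
  -- Every category to be exchanged lies below every category of `U`; `c` separates their counts.
  set c := ((S ∩ F) \ U).sup b
  calc ∑ x ∈ (S ∩ F) \ U, b x ≤ ((S ∩ F) \ U).card • c :=
        sum_le_card_nsmul _ _ _ fun x hx => le_sup hx
    _ ≤ (U \ (S ∩ F)).card • c := by
        refine Nat.mul_le_mul_right _ ?_
        have h1 := card_sdiff_add_card_inter (S ∩ F) U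
        have h2 := card_sdiff_add_card_inter U (S ∩ F)
        rw [inter_comm U] at h2
        omega
    _ ≤ ∑ x ∈ U \ (S ∩ F), b x := by
        refine card_nsmul_le_sum _ _ _ fun u hu => Finset.sup_le fun x hx => ?_
        have hu := (mem_sdiff.1 hu).1
        obtain ⟨hx, hxU⟩ := mem_sdiff.1 hx
        have hxF := (mem_inter.1 hx).2
        exact h.2 hxF (hU hu) (hup x hxF hxU u hu)

theorem exists_upper_subset_card_eq {k : ℕ} (F : Finset (Fin k)) (m : ℕ) (hm : m ≤ F.card) :
    ∃ U ⊆ F, U.card = m ∧ ∀ x ∈ F, x ∉ U → ∀ u ∈ U, x ≤ u := by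
  induction m with
  | zero => exact ⟨∅, by simp⟩
  | succ m ih =>
    obtain ⟨U, hU, hc, hup⟩ := ih (by omega)
    have hne : (F \ U).Nonempty := by
      rw [← card_pos, card_sdiff_of_subset hU]
      omega
    have hmem := mem_sdiff.1 (max'_mem _ hne)
    refine ⟨insert ((F \ U).max' hne) U, insert_subset hmem.1 hU, by
      rw [card_insert_of_notMem hmem.2, hc], fun x hx hx' u hu => ?_⟩
    rw [mem_insert, not_or] at hx'
    rcases mem_insert.1 hu with rfl | hu
    · exact le_max' _ _ (mem_sdiff.2 ⟨hx, hx'.2⟩)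
    · exact hup x hx hx'.2 u hu

/-- Counts may be added if the majorizing ones are sorted on the same set: the same upper set is
optimal for both summands. -/
theorem MajorizedBy.add_of_sorted {k : ℕ} {a₁ a₂ b₁ b₂ : Fin k → ℕ} {F : Finset (Fin k)}
    (h₁ : MajorizedBy a₁ b₁) (h₂ : MajorizedBy a₂ b₂) (hs₁ : SortedOn b₁ F)
    (hs₂ : SortedOn b₂ F) : MajorizedBy (a₁ + a₂) (b₁ + b₂) := by
  refine ⟨by simp [sum_add_distrib, h₁.1, h₂.1], fun S => ?_⟩
  obtain ⟨S₁, hc₁, hS₁⟩ := h₁.2 S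
  obtain ⟨S₂, hc₂, hS₂⟩ := h₂.2 S
  obtain ⟨U, hU, hc, hup⟩ := exists_upper_subset_card_eq F (min S.card F.card) (min_le_right _ _)
  have key : ∀ S' : Finset (Fin k), S'.card ≤ S.card → (S' ∩ F).card ≤ U.card := fun S' h => by
    rw [hc]
    exact le_min ((card_le_card inter_subset_left).trans h) (card_le_card inter_subset_right)
  refine ⟨U, by omega, ?_⟩
  simp only [Pi.add_apply, sum_add_distrib]
  exact add_le_add (hS₁.trans (hs₁.sum_le hU hup S₁ (key _ hc₁)))
    (hS₂.trans (hs₂.sum_le hU hup S₂ (key _ hc₂)))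

/-! ### Majorized counts have smaller likelihood -/

/-- Summation by parts in multiplicative form: moving exponents towards larger bases increases the
product. It needs no logarithms, so bases equal to zero are no exception. -/
theorem prod_pow_le_prod_pow_of_tail_le {k : ℕ} (q : Fin k → ENNReal) (hq : Monotone q)
    (a b : Fin k → ℕ)
    (htail : ∀ i, (∑ j, if i ≤ j then a j else 0) ≤ ∑ j, if i ≤ j then b j else 0)
    (htot : ∑ j, a j = ∑ j, b j) : ∏ j, q j ^ a j ≤ ∏ j, q j ^ b j := by
  induction k with
  | zero => simp
  | succ k ih =>
    cases k with
    | zero => simp at htot; simp [htot]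
    | succ k =>
      have h1 : ∑ j : Fin (k + 1), a j.succ ≤ ∑ j : Fin (k + 1), b j.succ := by
        have h := htail (Fin.succ 0)
        rw [Fin.sum_univ_succ, Fin.sum_univ_succ (n := k + 1)] at h
        simpa only [Fin.succ_le_succ_iff, Fin.zero_le, if_true, Fin.le_zero_iff, Fin.succ_ne_zero,
          if_false, zero_add] using h
      have hs := htot
      rw [Fin.sum_univ_succ, Fin.sum_univ_succ (n := k + 1)] at hs
      -- The surplus at the smallest base moves to the next one.
      obtain ⟨e, he⟩ : ∃ e, a 0 = b 0 + e := ⟨a 0 - b 0, by omega⟩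
      have := ih (fun j => q j.succ) (fun i j h => hq (Fin.succ_le_succ_iff.2 h))
        (fun j => a j.succ + if j = 0 then e else 0) (fun j => b j.succ) ?_ ?_
      · rw [Fin.prod_univ_succ, Fin.prod_univ_succ (n := k + 1) (fun j => q j ^ b j), he, pow_add,
          mul_assoc]
        refine mul_le_mul_right ((mul_le_mul_left (pow_le_pow_left' (hq (Fin.zero_le
          (Fin.succ 0))) e) _).trans (le_of_eq_of_le ?_ this)) _
        simp only [pow_add, prod_mul_distrib]
        rw [mul_comm]
        congr 1
        simp [pow_ite, prod_ite_eq']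
      · intro i
        rcases eq_or_ne i 0 with rfl | hi
        · simp [sum_add_distrib]
          omega
        · have hz : ∀ j : Fin (k + 1), (if i ≤ j then a j.succ + (if j = 0 then e else 0) else 0)
              = if i ≤ j then a j.succ else 0 := fun j => by
            split_ifs with h h'
            · subst h'
              exact absurd (Fin.le_zero_iff.1 h) hi
            · rfl
            · rfl
          have := htail i.succ
          rw [Fin.sum_univ_succ, Fin.sum_univ_succ (n := k + 1)] at this
          simpa [hz, Fin.succ_le_succ_iff] using this
      · simp [sum_add_distrib]
        omega

/-- If `a` is majorized by `b`, then the likelihood of `a` under any `q` is at most that of `b` under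
a rearrangement of `q`, namely the one that is ordered like `b`. -/
theorem MajorizedBy.exists_perm_prod_pow_le {k : ℕ} {a b : Fin k → ℕ} (h : MajorizedBy a b)
    (q : Fin k → ENNReal) :
    ∃ τ : Equiv.Perm (Fin k), ∏ x, q x ^ a x ≤ ∏ x, q (τ x) ^ b x := by
  set σ := Tuple.sort q
  set ρ := Tuple.sort b
  have hm := (h.comp_perm_left σ).comp_perm_right ρ
  have hsort : SortedOn (fun x => b (ρ x)) univ :=
    ⟨fun x hx => absurd (mem_univ x) hx, (Tuple.monotone_sort b).monotoneOn _⟩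
  have := prod_pow_le_prod_pow_of_tail_le (fun x => q (σ x)) (Tuple.monotone_sort q)
    (fun x => a (σ x)) (fun x => b (ρ x)) (fun i => ?_) hm.1
  · refine ⟨ρ⁻¹.trans σ, ?_⟩
    rw [Equiv.prod_comp σ (fun x => q x ^ a x)] at this
    refine this.trans_eq ?_
    rw [← Equiv.prod_comp ρ (fun x => q ((ρ⁻¹.trans σ) x) ^ b x)]
    simp
  · obtain ⟨S, hc, hs⟩ := hm.2 (Ici i)
    rw [← sum_filter, ← sum_filter]
    have e : (univ.filter fun j => i ≤ j) = Ici i := by ext; simp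
    rw [e]
    refine hs.trans (hsort.sum_le (subset_univ _) (fun x _ hx u hu => ?_) S (by simpa using hc))
    rw [mem_Ici] at hx hu
    exact (not_le.1 hx).le.trans hu

theorem MajorizedBy.exists_pmf_prod_pow_le {k : ℕ} {a b : Fin k → ℕ} (h : MajorizedBy a b)
    (q : PMF (Fin k)) : ∃ q' : PMF (Fin k), ∏ x, q x ^ a x ≤ ∏ x, q' x ^ b x := by
  obtain ⟨τ, hτ⟩ := h.exists_perm_prod_pow_le q
  have h1 : ∑ x, q (τ x) = 1 := by
    rw [Equiv.sum_comp τ q, ← q.tsum_coe, tsum_fintype]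
  exact ⟨PMF.ofFintype (fun x => q (τ x)) h1, by simpa using hτ⟩

/-- A most likely distribution exists because the probability simplex is compact. -/
theorem exists_pmf_forall_prod_pow_le {k : ℕ} (hk : 0 < k) (c : Fin k → ℕ) :
    ∃ q : PMF (Fin k), ∀ q' : PMF (Fin k), ∏ x, q' x ^ c x ≤ ∏ x, q x ^ c x := by
  have : Nonempty (Fin k) := ⟨⟨0, hk⟩⟩
  obtain ⟨f, hf, hmax⟩ := (isCompact_stdSimplex ℝ (Fin k)).exists_isMaxOn
    ⟨_, single_mem_stdSimplex ℝ (⟨0, hk⟩ : Fin k)⟩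
    (f := fun f : Fin k → ℝ => ∏ x, f x ^ c x) (by fun_prop)
  refine ⟨PMF.ofFintype (fun x => ENNReal.ofReal (f x)) ?_, fun q' => ?_⟩
  · rw [← ENNReal.ofReal_sum_of_nonneg fun x _ => hf.1 x, hf.2, ENNReal.ofReal_one]
  · have hq' : (fun x => (q' x).toReal) ∈ stdSimplex ℝ (Fin k) := by
      refine ⟨fun x => ENNReal.toReal_nonneg, ?_⟩
      rw [← ENNReal.toReal_sum fun x _ => q'.apply_ne_top x, ← ENNReal.toReal_one, ← q'.tsum_coe,
        tsum_fintype]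
    have h := ENNReal.ofReal_le_ofReal (hmax hq')
    simp only at h
    rw [ENNReal.ofReal_prod_of_nonneg fun x _ => pow_nonneg ENNReal.toReal_nonneg _,
      ENNReal.ofReal_prod_of_nonneg fun x _ => pow_nonneg (hf.1 x) _] at h
    simpa only [PMF.ofFintype_apply, ENNReal.ofReal_pow ENNReal.toReal_nonneg,
      ENNReal.ofReal_pow (hf.1 _), ENNReal.ofReal_toReal (q'.apply_ne_top _)] using h

/-! ### Routing in tree-structured permutations -/

@[simp] theorem IndepPerm.act_apply {d k : ℕ} (π : IndepPerm d k) (x : Config d k) (j : Fin d) :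
    π.act x j = π j (x j) := rfl

theorem IndepPerm.act_mul {d k : ℕ} (π ρ : IndepPerm d k) (x : Config d k) :
    (π * ρ).act x = π.act (ρ.act x) := rfl

@[simp] theorem IndepPerm.act_one {d k : ℕ} (x : Config d k) : (1 : IndepPerm d k).act x = x := rfl

/-- The input `x` of the root passes through the node with the given address. -/
def TSP.Reaches {d k : ℕ} : TSP d k → Config d k → Address → Prop
  | _, _, [] => True
  | .leaf _, _, _ :: _ => False
  | .node π s v l _, x, Side.left :: p => π.act x s ∈ v ∧ l.Reaches (π.act x) p
  | .node π s v _ r, x, Side.right :: p => π.act x s ∉ v ∧ r.Reaches (π.act x) p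

theorem leftDomain_subset {d k : ℕ} {E : Set (Config d k)} {π : IndepPerm d k}
    (h : ∀ x ∈ E, π.act x ∈ E) (s : Fin d) (v : Finset (Fin k)) : leftDomain E π s v ⊆ E := by
  rintro _ ⟨x, hx, -, rfl⟩
  exact h x hx

theorem rightDomain_subset {d k : ℕ} {E : Set (Config d k)} {π : IndepPerm d k}
    (h : ∀ x ∈ E, π.act x ∈ E) (s : Fin d) (v : Finset (Fin k)) : rightDomain E π s v ⊆ E := by
  rintro _ ⟨x, hx, -, rfl⟩
  exact h x hx

theorem TSP.IsValidFrom.eval_mem {d k : ℕ} {B : TSP d k} {E : Set (Config d k)}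
    (h : B.IsValidFrom E) {x : Config d k} (hx : x ∈ E) : B.eval x ∈ E := by
  induction B generalizing E x with
  | leaf π => exact h x hx
  | node π s v l r ihl ihr =>
    obtain ⟨h, hl, hr⟩ := h
    simp only [TSP.eval]
    split_ifs with hv
    · exact leftDomain_subset h s v (ihl hl ⟨x, hx, hv, rfl⟩)
    · exact rightDomain_subset h s v (ihr hr ⟨x, hx, hv, rfl⟩)

theorem TSP.IsValidFrom.domainFrom_subset {d k : ℕ} {B : TSP d k} {E : Set (Config d k)}
    (h : B.IsValidFrom E) (p : Address) : B.domainFrom E p ⊆ E := by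
  induction B generalizing E p with
  | leaf π => cases p <;> simp [TSP.domainFrom]
  | node π s v l r ihl ihr =>
    obtain ⟨h, hl, hr⟩ := h
    match p with
    | [] => exact subset_rfl
    | Side.left :: p => exact (ihl hl p).trans (leftDomain_subset h s v)
    | Side.right :: p => exact (ihr hr p).trans (rightDomain_subset h s v)

/-- In a valid tree the output lies in the domain of a node exactly if the input passes through the
node: the subtree below a node preserves the domain of the node, and the domains of siblings are
disjoint. -/
theorem TSP.IsValidFrom.eval_mem_domainFrom_iff {d k : ℕ} {B : TSP d k} {E : Set (Config d k)}
    (h : B.IsValidFrom E) {x : Config d k} (hx : x ∈ E) (p : Address) :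
    B.eval x ∈ B.domainFrom E p ↔ B.Reaches x p := by
  induction B generalizing E x p with
  | leaf π =>
    cases p with
    | nil => simpa [TSP.domainFrom, TSP.Reaches, TSP.eval] using h x hx
    | cons a p => simp [TSP.domainFrom, TSP.Reaches]
  | node π s v l r ihl ihr =>
    have he := h.eval_mem hx
    obtain ⟨h, hl, hr⟩ := h
    match p with
    | [] => simpa [TSP.domainFrom, TSP.Reaches] using he
    | Side.left :: p =>
      simp only [TSP.eval, TSP.domainFrom, TSP.Reaches]
      split_ifs with hv
      · rw [ihl hl ⟨x, hx, hv, rfl⟩]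
        exact (and_iff_right hv).symm
      · refine iff_of_false (fun hm => ?_) fun hm => hv hm.1
        obtain ⟨y, -, hy, e⟩ := hl.domainFrom_subset p hm
        obtain ⟨z, -, hz, e'⟩ := hr.eval_mem ⟨x, hx, hv, rfl⟩
        exact hz (by rwa [← e', e])
    | Side.right :: p =>
      simp only [TSP.eval, TSP.domainFrom, TSP.Reaches]
      split_ifs with hv
      · refine iff_of_false (fun hm => ?_) fun hm => hm.1 hv
        obtain ⟨y, -, hy, e⟩ := hr.domainFrom_subset p hm
        obtain ⟨z, -, hz, e'⟩ := hl.eval_mem ⟨x, hx, hv, rfl⟩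
        exact hy (by rwa [← e, e'])
      · rw [ihr hr ⟨x, hx, hv, rfl⟩]
        exact (and_iff_right hv).symm

theorem SplitTree.isValidFrom_toTSP {d k : ℕ} (T : SplitTree d k) (D : Set (Config d k)) :
    T.toTSP.IsValidFrom D := by
  induction T generalizing D with
  | leaf => exact fun x hx => hx
  | node s v l r ihl ihr => exact ⟨fun x hx => hx, ihl _, ihr _⟩

/-- The tree `B` has the shape of `T` and sends `ρ(x)` along the path along which `T` sends `x`, for
every `x ∈ D`. The permutation `ρ` accounts for the ancestors of the root of `B`. -/
def Routes {d k : ℕ} : TSP d k → SplitTree d k → IndepPerm d k → Set (Config d k) → Prop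
  | .leaf _, .leaf, _, _ => True
  | .node π s' v' l' r', .node s v l r, ρ, D =>
      (∀ x ∈ D, (π * ρ).act x s' ∈ v' ↔ x s ∈ v) ∧
        Routes l' l (π * ρ) {x ∈ D | x s ∈ v} ∧ Routes r' r (π * ρ) {x ∈ D | x s ∉ v}
  | _, _, _, _ => False

theorem TSP.nil_mem_nodes {d k : ℕ} (B : TSP d k) : [] ∈ B.nodes := by
  cases B <;> simp [TSP.nodes]

@[simp] theorem TSP.left_cons_mem_nodes {d k : ℕ} {π : IndepPerm d k} {s : Fin d}
    {v : Finset (Fin k)} {l r : TSP d k} {p : Address} :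
    Side.left :: p ∈ (TSP.node π s v l r).nodes ↔ p ∈ l.nodes := by
  simp [TSP.nodes]

@[simp] theorem TSP.right_cons_mem_nodes {d k : ℕ} {π : IndepPerm d k} {s : Fin d}
    {v : Finset (Fin k)} {l r : TSP d k} {p : Address} :
    Side.right :: p ∈ (TSP.node π s v l r).nodes ↔ p ∈ r.nodes := by
  simp [TSP.nodes]

theorem routes_iff {d k : ℕ} (B : TSP d k) (T : SplitTree d k) (ρ : IndepPerm d k)
    (D : Set (Config d k)) :
    Routes B T ρ D ↔ B.nodes = T.toTSP.nodes ∧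
      ∀ p ∈ B.nodes, ∀ x ∈ D, B.Reaches (ρ.act x) p ↔ T.toTSP.Reaches x p := by
  induction B generalizing T ρ D with
  | leaf π =>
    cases T with
    | leaf => simp [Routes, TSP.nodes, SplitTree.toTSP, TSP.Reaches]
    | node s v l r =>
      refine iff_of_false id fun h => ?_
      have h := h.1.symm ▸ TSP.left_cons_mem_nodes.2 (TSP.nil_mem_nodes l.toTSP)
      simp [TSP.nodes] at h
  | node π s' v' l' r' ihl ihr =>
    cases T with
    | leaf =>
      refine iff_of_false id fun h => ?_
      have h := h.1 ▸ TSP.left_cons_mem_nodes.2 (TSP.nil_mem_nodes l')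
      simp [TSP.nodes, SplitTree.toTSP] at h
    | node s v l r =>
      simp only [Routes, ihl, ihr]
      constructor
      · rintro ⟨hs, ⟨hnl, hl⟩, hnr, hr⟩
        refine ⟨by simp only [TSP.nodes, SplitTree.toTSP, hnl, hnr], fun p hp x hx => ?_⟩
        have hs := hs x hx
        rw [IndepPerm.act_mul] at hs
        match p with
        | [] => simp [TSP.Reaches]
        | Side.left :: p =>
          simp only [TSP.Reaches, SplitTree.toTSP, hs, IndepPerm.act_one]
          exact and_congr_right fun hv => hl p (TSP.left_cons_mem_nodes.1 hp) x ⟨hx, hv⟩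
        | Side.right :: p =>
          simp only [TSP.Reaches, SplitTree.toTSP, hs, IndepPerm.act_one]
          exact and_congr_right fun hv => hr p (TSP.right_cons_mem_nodes.1 hp) x ⟨hx, hv⟩
      · rintro ⟨hn, h⟩
        have hs : ∀ x ∈ D, (π * ρ).act x s' ∈ v' ↔ x s ∈ v := fun x hx => by
          have := h [Side.left] (TSP.left_cons_mem_nodes.2 (TSP.nil_mem_nodes _)) x hx
          simpa [TSP.Reaches, SplitTree.toTSP] using this
        refine ⟨hs, ⟨?_, fun p hp x hx => ?_⟩, ?_, fun p hp x hx => ?_⟩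
        · ext p
          rw [← TSP.left_cons_mem_nodes (π := π) (s := s') (v := v') (r := r'), hn]
          exact TSP.left_cons_mem_nodes
        · have h := h _ (TSP.left_cons_mem_nodes.2 hp) x hx.1
          simp only [TSP.Reaches, SplitTree.toTSP, ← IndepPerm.act_mul, hs x hx.1,
            IndepPerm.act_one] at h
          rwa [and_iff_right hx.2, and_iff_right hx.2] at h
        · ext p
          rw [← TSP.right_cons_mem_nodes (π := π) (s := s') (v := v') (l := l'), hn]
          exact TSP.right_cons_mem_nodes
        · have h := h _ (TSP.right_cons_mem_nodes.2 hp) x hx.1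
          simp only [TSP.Reaches, SplitTree.toTSP, ← IndepPerm.act_mul, hs x hx.1,
            IndepPerm.act_one] at h
          rwa [and_iff_right hx.2, and_iff_right hx.2] at h

theorem mem_equivalentTSPs_iff {d k : ℕ} {B : TSP d k} {T : SplitTree d k} :
    B ∈ equivalentTSPs T ↔ B.IsValid ∧ Routes B T 1 Set.univ := by
  refine and_congr_right fun hB => ?_
  rw [routes_iff]
  refine and_congr_right fun _ => forall₂_congr fun p _ => ?_
  simp only [Set.mem_univ, true_imp_iff, IndepPerm.act_one]
  refine forall_congr' fun x => ?_
  unfold TSP.domain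
  rw [hB.eval_mem_domainFrom_iff (Set.mem_univ x),
    (T.isValidFrom_toTSP _).eval_mem_domainFrom_iff (Set.mem_univ x)]

theorem leftDomain_image {d k : ℕ} {D : Set (Config d k)} {π ρ : IndepPerm d k} {s s' : Fin d}
    {v v' : Finset (Fin k)} (h : ∀ x ∈ D, (π * ρ).act x s' ∈ v' ↔ x s ∈ v) :
    leftDomain (ρ.act '' D) π s' v' = (π * ρ).act '' {x ∈ D | x s ∈ v} := by
  ext y
  constructor
  · rintro ⟨_, ⟨x, hx, rfl⟩, hv, rfl⟩
    exact ⟨x, ⟨hx, (h x hx).1 hv⟩, rfl⟩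
  · rintro ⟨x, ⟨hx, hv⟩, rfl⟩
    exact ⟨_, ⟨x, hx, rfl⟩, (h x hx).2 hv, rfl⟩

theorem rightDomain_image {d k : ℕ} {D : Set (Config d k)} {π ρ : IndepPerm d k} {s s' : Fin d}
    {v v' : Finset (Fin k)} (h : ∀ x ∈ D, (π * ρ).act x s' ∈ v' ↔ x s ∈ v) :
    rightDomain (ρ.act '' D) π s' v' = (π * ρ).act '' {x ∈ D | x s ∉ v} := by
  ext y
  constructor
  · rintro ⟨_, ⟨x, hx, rfl⟩, hv, rfl⟩
    exact ⟨x, ⟨hx, mt (h x hx).2 hv⟩, rfl⟩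
  · rintro ⟨x, ⟨hx, hv⟩, rfl⟩
    exact ⟨_, ⟨x, hx, rfl⟩, mt (h x hx).1 hv, rfl⟩

/-! ### Counts of the outputs -/

open scoped Classical in
/-- The number of samples in `D` whose output has category `a` in feature `j`, where the tree `B`
receives the sample `x` in the form `ρ(x)`. -/
noncomputable def outCounts {n d k : ℕ} (X : Fin n → Config d k) (B : TSP d k) (ρ : IndepPerm d k)
    (D : Set (Config d k)) : Counts d k :=
  fun j a => (univ.filter fun i => B.eval (ρ.act (X i)) j = a ∧ X i ∈ D).card

theorem outCounts_leaf {n d k : ℕ} (X : Fin n → Config d k) (π ρ : IndepPerm d k)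
    (D : Set (Config d k)) :
    outCounts X (.leaf π) ρ D = permuteCounts (π * ρ) (rawCounts X D) := by
  ext j a
  simp only [outCounts, permuteCounts, rawCounts]
  congr 1
  ext i
  simp only [mem_filter, mem_univ, true_and, Equiv.Perm.eq_inv_iff_eq]
  rfl

theorem outCounts_node {n d k : ℕ} (X : Fin n → Config d k) {π ρ : IndepPerm d k} {s s' : Fin d}
    {v v' : Finset (Fin k)} {D : Set (Config d k)}
    (h : ∀ x ∈ D, (π * ρ).act x s' ∈ v' ↔ x s ∈ v) (l r : TSP d k) :
    outCounts X (.node π s' v' l r) ρ D =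
      outCounts X l (π * ρ) {x ∈ D | x s ∈ v} + outCounts X r (π * ρ) {x ∈ D | x s ∉ v} := by
  classical
  ext j a
  simp only [outCounts, Pi.add_apply]
  rw [← card_filter_add_card_filter_not (fun i => X i s ∈ v), filter_filter, filter_filter]
  congr 2 <;> ext i <;> simp only [mem_filter, mem_univ, true_and]
  all_goals
    by_cases hD : X i ∈ D
    · have h := h _ hD
      rw [IndepPerm.act_mul] at h
      by_cases hv : X i s ∈ v <;> simp [TSP.eval, IndepPerm.act_mul, hD, hv, h, -IndepPerm.act_apply]
    · simp [hD]

theorem TSP.IsValidFrom.outCounts_eq_zero {n d k : ℕ} (X : Fin n → Config d k) {B : TSP d k}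
    {ρ : IndepPerm d k} {D : Set (Config d k)} (h : B.IsValidFrom (ρ.act '' D)) {j : Fin d}
    {a : Fin k} (ha : ∀ x ∈ D, ρ j (x j) ≠ a) : outCounts X B ρ D j a = 0 := by
  classical
  rw [outCounts, card_eq_zero, filter_eq_empty_iff]
  rintro i - ⟨e, hi⟩
  obtain ⟨x, hx, e'⟩ := h.eval_mem ⟨X i, hi, rfl⟩
  exact ha x hx (by rw [← e, ← e', IndepPerm.act_apply])

/-! ### Node domains of a tree structure -/

theorem mem_featureDomain {d k : ℕ} {D : Set (Config d k)} {j : Fin d} {a : Fin k} :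
    a ∈ featureDomain D j ↔ ∃ x ∈ D, x j = a := by
  simp [featureDomain]

/-- A set of configurations that is the product of its feature domains. -/
def IsBox {d k : ℕ} (D : Set (Config d k)) : Prop :=
  ∀ x : Config d k, (∀ j, x j ∈ featureDomain D j) → x ∈ D

theorem IsBox.univ {d k : ℕ} : IsBox (Set.univ : Set (Config d k)) := fun x _ => Set.mem_univ x

theorem IsBox.split {d k : ℕ} {D : Set (Config d k)} (h : IsBox D) (s : Fin d)
    (P : Fin k → Prop) : IsBox {x ∈ D | P (x s)} := by
  intro x hx
  refine ⟨h x fun j => ?_, ?_⟩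
  · obtain ⟨y, hy, e⟩ := mem_featureDomain.1 (hx j)
    exact mem_featureDomain.2 ⟨y, hy.1, e⟩
  · obtain ⟨y, hy, e⟩ := mem_featureDomain.1 (hx s)
    exact e ▸ hy.2

/-- Splitting a box at the feature `s` leaves the domains of the other features as they are. -/
theorem IsBox.featureDomain_split {d k : ℕ} {D : Set (Config d k)} (h : IsBox D) {s j : Fin d}
    (hj : j ≠ s) {P : Fin k → Prop} (hne : {x ∈ D | P (x s)}.Nonempty) :
    featureDomain {x ∈ D | P (x s)} j = featureDomain D j := by
  ext a
  simp only [mem_featureDomain]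
  constructor
  · rintro ⟨x, hx, e⟩
    exact ⟨x, hx.1, e⟩
  · rintro ⟨x, hx, rfl⟩
    obtain ⟨y, hy, hP⟩ := hne
    refine ⟨Function.update x s (y s), ⟨h _ fun i => ?_, by simpa using hP⟩, by simp [hj]⟩
    rcases eq_or_ne i s with rfl | hi
    · simpa using mem_featureDomain.2 ⟨y, hy, rfl⟩
    · simpa [hi] using mem_featureDomain.2 ⟨x, hx, rfl⟩

/-- An independent permutation that preserves every feature domain preserves a box. -/
theorem IsBox.act_mem {d k : ℕ} {D : Set (Config d k)} (h : IsBox D) {π : IndepPerm d k}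
    (hπ : ∀ j, ∀ a ∈ featureDomain D j, π j a ∈ featureDomain D j) {x : Config d k} (hx : x ∈ D) :
    π.act x ∈ D :=
  h _ fun j => hπ j _ (mem_featureDomain.2 ⟨x, hx, rfl⟩)

theorem IsBox.conj_act_mem {d k : ℕ} {D : Set (Config d k)} (h : IsBox D) {π : IndepPerm d k}
    (ρ : IndepPerm d k) (hπ : ∀ j, ∀ a ∈ featureDomain D j, π j a ∈ featureDomain D j) :
    ∀ y ∈ ρ.act '' D, (ρ * π * ρ⁻¹).act y ∈ ρ.act '' D := by
  rintro _ ⟨x, hx, rfl⟩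
  refine ⟨π.act x, h.act_mem hπ hx, ?_⟩
  rw [← IndepPerm.act_mul, ← IndepPerm.act_mul, inv_mul_cancel_right]

/-! ### Sorted local counts -/

theorem sort1D_mem {k : ℕ} (tie : TieBreak k) (c : Fin k → ℕ) {D : Finset (Fin k)} {a : Fin k}
    (ha : a ∈ D) : sort1D tie c D a ∈ D :=
  (Equiv.Perm.ofSubtype_apply_mem_iff_mem _ a).2 ha

theorem sort1D_inv_apply_orderIsoOfFin {k : ℕ} (tie : TieBreak k) (c : Fin k → ℕ)
    (D : Finset (Fin k)) (i : Fin D.card) :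
    (sort1D tie c D)⁻¹ (D.orderIsoOfFin rfl i) =
      D.orderIsoOfFin rfl (Tuple.sort (fun i => toLex (c (D.orderIsoOfFin rfl i),
        tie c D (D.orderIsoOfFin rfl i))) i) := by
  rw [Equiv.Perm.inv_eq_iff_eq]
  simp [sort1D, Equiv.Perm.ofSubtype_apply_coe, -coe_orderIsoOfFin_apply]

theorem sortedOn_permute_sort1D {k : ℕ} (tie : TieBreak k) (c : Fin k → ℕ) (D : Finset (Fin k))
    (hc : ∀ a ∉ D, c a = 0) : SortedOn (fun a => c ((sort1D tie c D)⁻¹ a)) D := by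
  refine ⟨fun a ha => ?_, fun a ha b hb hab => ?_⟩
  · have e : (sort1D tie c D)⁻¹ a = a := by
      rw [Equiv.Perm.inv_eq_iff_eq]
      exact (Equiv.Perm.ofSubtype_apply_of_not_mem _ ha).symm
    simp only [e, hc a ha]
  · obtain ⟨i, hi⟩ := (D.orderIsoOfFin rfl).surjective ⟨a, ha⟩
    obtain ⟨i', hi'⟩ := (D.orderIsoOfFin rfl).surjective ⟨b, hb⟩
    have hii : i ≤ i' := by
      rw [← (D.orderIsoOfFin rfl).le_iff_le, hi, hi']
      exact hab
    have ha' : a = D.orderIsoOfFin rfl i := by rw [hi]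
    have hb' : b = D.orderIsoOfFin rfl i' := by rw [hi']
    have := Tuple.monotone_sort (fun i => toLex (c (D.orderIsoOfFin rfl i),
        tie c D (D.orderIsoOfFin rfl i))) hii
    have := Prod.Lex.monotone_fst _ _ this
    simp only
    rw [ha', hb', sort1D_inv_apply_orderIsoOfFin, sort1D_inv_apply_orderIsoOfFin]
    exact this

theorem sortedOn_counts {n d k : ℕ} (tie : TieBreak k) (X : Fin n → Config d k)
    (T : SplitTree d k) (D : Set (Config d k)) (j : Fin d) :
    SortedOn ((learnLocalPermutations tie X T D).counts j) (featureDomain D j) := by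
  induction T generalizing D with
  | leaf =>
    refine sortedOn_permute_sort1D tie (rawCounts X D j) _ fun a ha => ?_
    classical
    rw [rawCounts, card_eq_zero, filter_eq_empty_iff]
    rintro i - ⟨e, hi⟩
    exact ha (mem_featureDomain.2 ⟨_, hi, e⟩)
  | node s v l r ihl ihr =>
    refine sortedOn_permute_sort1D tie
      ((learnLocalPermutations tie X l {x ∈ D | x s ∈ v}).counts j +
        (learnLocalPermutations tie X r {x ∈ D | x s ∉ v}).counts j) _ fun a ha => ?_
    have hsub : ∀ P : Config d k → Prop, a ∉ featureDomain {x ∈ D | P x} j := fun P h => by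
      obtain ⟨x, hx, e⟩ := mem_featureDomain.1 h
      exact ha (mem_featureDomain.2 ⟨x, hx.1, e⟩)
    simp only [Pi.add_apply]
    rw [(ihl _).1 a (hsub _), (ihr _).1 a (hsub _)]

/-! ### The learned tree -/

theorem routes_learned {n d k : ℕ} (tie : TieBreak k) (X : Fin n → Config d k)
    (T : SplitTree d k) (D : Set (Config d k)) (ρ : IndepPerm d k) :
    Routes (constructEquivalentTree (learnLocalPermutations tie X T D) ρ) T ρ D := by
  induction T generalizing D ρ with
  | leaf => trivial
  | node s v l r ihl ihr => exact ⟨fun x _ => by simp, ihl _ _, ihr _ _⟩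

theorem isValidFrom_learned {n d k : ℕ} (tie : TieBreak k) (X : Fin n → Config d k)
    (T : SplitTree d k) {D : Set (Config d k)} (hD : IsBox D) (ρ : IndepPerm d k) :
    (constructEquivalentTree (learnLocalPermutations tie X T D) ρ).IsValidFrom (ρ.act '' D) := by
  induction T generalizing D ρ with
  | leaf => exact hD.conj_act_mem ρ fun j a ha => sort1D_mem tie _ ha
  | node s v l r ihl ihr =>
    have hr := routes_learned tie X (.node s v l r) D ρ
    refine ⟨hD.conj_act_mem ρ fun j a ha => sort1D_mem tie _ ha, ?_, ?_⟩
    · rw [leftDomain_image hr.1]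
      exact ihl (hD.split s (· ∈ v)) _
    · rw [rightDomain_image hr.1]
      exact ihr (hD.split s (· ∉ v)) _

/-- The outputs of the learned tree have the local counts of the first pass, up to the permutation
that the ancestors contribute. -/
theorem outCounts_learned {n d k : ℕ} (tie : TieBreak k) (X : Fin n → Config d k)
    (T : SplitTree d k) (D : Set (Config d k)) (ρ : IndepPerm d k) :
    outCounts X (constructEquivalentTree (learnLocalPermutations tie X T D) ρ) ρ D =
      permuteCounts ρ (learnLocalPermutations tie X T D).counts := by
  induction T generalizing D ρ with
  | leaf =>
    simp only [learnLocalPermutations, constructEquivalentTree, outCounts_leaf, LocalTree.counts]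
    ext j a
    simp [permuteCounts]
  | node s v l r ihl ihr =>
    have hr := routes_learned tie X (.node s v l r) D ρ
    refine (outCounts_node X hr.1 _ _).trans ?_
    simp only [inv_mul_cancel_right] at ihl ihr ⊢
    rw [ihl, ihr]
    ext j a
    simp [permuteCounts, learnLocalPermutations, LocalTree.counts]

/-- The local counts of the first pass majorize the output counts of every valid tree with the same
routing. At a split the counts of the children are added. In the split feature the two summands of
the competing tree have disjoint supports, since both children see the same bijective image of
disjoint sets of categories. In any other feature the children's local counts are sorted on the same
feature domain. -/
theorem outCounts_majorizedBy {n d k : ℕ} (tie : TieBreak k) (X : Fin n → Config d k)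
    (T : SplitTree d k) {D : Set (Config d k)} (hD : IsBox D) (B : TSP d k) (ρ : IndepPerm d k)
    (hB : B.IsValidFrom (ρ.act '' D)) (hR : Routes B T ρ D) (j : Fin d) :
    MajorizedBy (outCounts X B ρ D j) ((learnLocalPermutations tie X T D).counts j) := by
  induction T generalizing D B ρ with
  | leaf =>
    cases B with
    | node => exact hR.elim
    | leaf π =>
      rw [outCounts_leaf]
      exact ((MajorizedBy.refl _).comp_perm_left _).comp_perm_right _
  | node s v l r ihl ihr =>
    cases B with
    | leaf => exact hR.elim
    | node π s' v' l' r' =>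
      obtain ⟨hs, hRl, hRr⟩ := hR
      obtain ⟨-, hBl, hBr⟩ := hB
      rw [leftDomain_image hs] at hBl
      rw [rightDomain_image hs] at hBr
      have hDl := hD.split s (· ∈ v)
      have hDr := hD.split s (· ∉ v)
      have hl := ihl hDl l' _ hBl hRl
      have hr := ihr hDr r' _ hBr hRr
      rw [outCounts_node X hs]
      refine MajorizedBy.comp_perm_right
        (b := (learnLocalPermutations tie X l {x ∈ D | x s ∈ v}).counts j +
          (learnLocalPermutations tie X r {x ∈ D | x s ∉ v}).counts j) ?_ _
      rcases eq_or_ne j s with rfl | hj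
      · refine hl.add_of_disjoint hr fun a => ?_
        by_contra! hne
        have h1 := mt (hBl.outCounts_eq_zero X) hne.1
        have h2 := mt (hBr.outCounts_eq_zero X) hne.2
        push Not at h1 h2
        obtain ⟨x, hx, ex⟩ := h1
        obtain ⟨y, hy, ey⟩ := h2
        exact hy.2 ((((π * ρ) j).injective (ex.trans ey.symm)) ▸ hx.2)
      · have sorted : ∀ (T' : SplitTree d k) (P : Fin k → Prop),
            SortedOn ((learnLocalPermutations tie X T' {x ∈ D | P (x s)}).counts j)
              (featureDomain D j) := fun T' P => by
          have h := sortedOn_counts tie X T' {x ∈ D | P (x s)} j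
          rcases Set.eq_empty_or_nonempty {x ∈ D | P (x s)} with he | hne
          · refine SortedOn.of_empty ?_ _
            convert h
            simp [he, featureDomain]
          · rwa [hD.featureDomain_split hj hne] at h
        exact hl.add_of_sorted hr (sorted l (· ∈ v)) (sorted r (· ∉ v))

/-! ### Likelihoods -/

theorem prod_prod_eq_prod_pow_outCounts {n d k : ℕ} (X : Fin n → Config d k) (B : TSP d k)
    (Q : Fin d → PMF (Fin k)) :
    ∏ i, ∏ j, Q j (B.eval (X i) j) = ∏ j, ∏ a, Q j a ^ outCounts X B 1 Set.univ j a := by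
  rw [prod_comm]
  refine prod_congr rfl fun j _ => ?_
  rw [← prod_fiberwise' univ (fun i => B.eval (X i) j) (Q j)]
  refine prod_congr rfl fun a _ => ?_
  rw [prod_const, outCounts]
  congr 2
  ext i
  simp

theorem nll_le_nll {n d k : ℕ} (X : Fin n → Config d k) {B B' : TSP d k}
    {Q Q' : Fin d → PMF (Fin k)}
    (h : ∀ j, ∏ a, Q' j a ^ outCounts X B' 1 Set.univ j a ≤
      ∏ a, Q j a ^ outCounts X B 1 Set.univ j a) : nll X B Q ≤ nll X B' Q' := by
  have log_prod : ∀ f : Fin n → ENNReal, ∑ i, ENNReal.log (f i) = ENNReal.log (∏ i, f i) :=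
    fun f => by
      induction (univ : Finset (Fin n)) using Finset.induction_on with
      | empty => simp
      | insert i s hi ih => rw [sum_insert hi, prod_insert hi, ENNReal.log_mul_add, ih]
  unfold nll
  rw [log_prod, log_prod, prod_prod_eq_prod_pow_outCounts, prod_prod_eq_prod_pow_outCounts,
    EReal.neg_le_neg_iff]
  refine mul_le_mul_of_nonneg_left (ENNReal.log_monotone (prod_le_prod' fun j _ => h j)) ?_
  -- For `n = 0` the factor is `1 / 0 = 0` in `EReal`.
  exact EReal.div_nonneg zero_le_one (by positivity)

theorem exists_nll_eq_optNLL {n d k : ℕ} (hk : 0 < k) (X : Fin n → Config d k) (B : TSP d k) :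
    ∃ Q : Fin d → PMF (Fin k), nll X B Q = optNLL X B := by
  choose Q hQ using fun j => exists_pmf_forall_prod_pow_le hk (outCounts X B 1 Set.univ j)
  exact ⟨Q, le_antisymm (le_iInf fun Q' => nll_le_nll X fun j => hQ j (Q' j)) (iInf_le _ Q)⟩

theorem optNLL_le_optNLL {n d k : ℕ} (X : Fin n → Config d k) {B B' : TSP d k}
    (h : ∀ j, MajorizedBy (outCounts X B' 1 Set.univ j) (outCounts X B 1 Set.univ j)) :
    optNLL X B ≤ optNLL X B' := by
  refine le_iInf fun Q' => ?_
  choose Q hQ using fun j => (h j).exists_pmf_prod_pow_le (Q' j)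
  exact (iInf_le _ Q).trans (nll_le_nll X hQ)

end TreeFlow

theorem mainTheorem2 {n d k : ℕ} (hk : 0 < k) (tie : TieBreak k) (X : Fin n → Config d k)
    (T : SplitTree d k) :
    learnedTSP tie X T ∈ equivalentTSPs T ∧
      (∀ B ∈ equivalentTSPs T, optNLL X (learnedTSP tie X T) ≤ optNLL X B) ∧
      (∀ B ∈ equivalentTSPs T, ∃ Q : Fin d → PMF (Fin k), nll X B Q = optNLL X B) := by
  have image_one : ∀ D : Set (Config d k), (1 : IndepPerm d k).act '' D = D := fun D =>
    Set.image_id D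
  refine ⟨mem_equivalentTSPs_iff.2 ⟨?_, routes_learned tie X T _ 1⟩, fun B hB => ?_,
    fun B _ => exists_nll_eq_optNLL hk X B⟩
  · have h := isValidFrom_learned tie X T IsBox.univ 1
    rwa [image_one] at h
  · obtain ⟨hV, hR⟩ := mem_equivalentTSPs_iff.1 hB
    refine optNLL_le_optNLL X fun j => ?_
    have h := outCounts_majorizedBy tie X T IsBox.univ B 1 (by rwa [image_one]) hR j
    rw [learnedTSP, outCounts_learned]
    exact h.comp_perm_right _
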